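/- **Setting.** A sender observes a state $\theta$ in a finite set $\Theta$, drawn from a prior $\mu\in\Delta\Theta$, and sends a message $m$ from an arbitrary discrete set $M$; a receiver then takes a possibly mixed action $p\in\Delta\mathcal A$, where $\mathcal A$ is finite. Fix a transparent (state-independent) sender utility $u^0:\mathcal A\times M\to\mathbb R$ and a receiver utility $u_R\in\mathbb R^{\mathcal A\times\Theta}$, both extended linearly to mixed actions, and assume (S): $u^0(a,m)\ne u^0(a',m')$ for all $a\neq a'$ in $\mathcal A$ and all $m,m'\in M$. (Message-independent $u^0$, i.e. cheap talk, is included.) A *candidate equilibrium* is a perfect Bayesian equilibrium of this game: a sender strategy $\mathscr M:\Theta\to\Delta M$, beliefs $\nu:M\to\Delta\Theta$ and actions $\mathscr P:M\to\Delta\mathcal A$ such that every message sent in any state maximizes $m\mapsto u^0(\mathscr P(m),m)$ over $M$, $\nu$ is given by Bayes' rule after messages of positive probability, and $\mathscr P(m)$ is a receiver best response to $\nu(m)$ for every $m$. Its *communication graph* is the bipartite graph with nodes the states $\theta$ and the on-path pairs $\pi=(\mathscr P(m),m)$, with an edge between $\theta$ and $\pi=(\mathscr P(m),m)$ if $m\in\operatorname{supp}\mathscr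 M(\theta)$. The equilibrium is *acyclic* if this graph has no cycle, and a *forest* equilibrium if it is acyclic but not connected. It is *irredundant* if no two distinct on-path messages recommend the same pure action. Two equilibria are *informationally equivalent* if they induce the same distribution of posterior beliefs. Consider the properties - (a) there is no irredundant forest candidate equilibrium; - (b) in every acyclic candidate equilibrium, exactly one pure action is recommended on path; - (c) in every irredundant acyclic candidate equilibrium, all on-path non-pure actions are binary ($|\operatorname{supp}p|=2$); - (d) up to information equivalence there are finitely many irredundant acyclic candidate equilibria, and each is identified by its communication graph: two of them whose communication graphs are isomorphic, by an isomorphism that fixes every state and preserves the recommended action of every on-path pair, are informationally equivalent. **Theorem.** 1. If $\mu(\theta)>0$ for all $\theta$, then (a)–(d) hold for Lebesgue-almost every $u_R\in\mathbb R^{\mathcal A\times\Theta}$. 2. If $u_R$ satisfies (R): *whenever $a\ne a'$ are both best responses to a belief $\nu$, there is $\theta\in\operatorname{supp}\nu$ with $u_R(a|\theta)\ne u_R(a'|\theta)$*, then (a) and (b) hold for Lebesgue-almost every prior $\mu\in\Delta\Theta$. 3. If $u_R$ satisfies (R$^*$): *whenever $a,a',a''$ (not necessarily distinct) are best responses to a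 belief $\nu$ and $p,p'\in\Delta\{a,a',a''\}$ satisfy $u_R(p|\theta)=u_R(p'|\theta)$ for all $\theta\in\operatorname{supp}\nu$, then $p=p'$*, then (a)–(d) hold for Lebesgue-almost every prior $\mu\in\Delta\Theta$. -/

import Mathlib

open MeasureTheory

/-- A strategy profile together with a belief system, in the game where a sender observes a state
in `Θ`, sends a message in the discrete space `M`, and a receiver then takes an action in `Δ A`. -/
structure Profile (Θ A M : Type*) where
  /-- the sender's (behaviour) strategy `Θ → Δ M` -/
  send : Θ → PMF M
  /-- the receiver's posterior belief after each message -/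
  belief : M → PMF Θ
  /-- the receiver's (possibly mixed) action after each message -/
  act : M → PMF A

/-- The transparent (state-independent) sender utility, extended linearly to mixed actions. -/
noncomputable def senderUtil {A M : Type*} [Fintype A] (u0 : A → M → ℝ) (p : PMF A) (m : M) : ℝ :=
  ∑ a, (p a).toReal * u0 a m

/-- The receiver utility in a state, extended linearly to mixed actions. -/
noncomputable def receiverUtil {Θ A : Type*} [Fintype A] (uR : A → Θ → ℝ) (p : PMF A) (θ : Θ) : ℝ :=
  ∑ a, (p a).toReal * uR a θ

/-- The receiver's expected utility of the mixed action `p` under the belief `ν`. -/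
noncomputable def receiverExp {Θ A : Type*} [Fintype Θ] [Fintype A] (uR : A → Θ → ℝ)
    (p : PMF A) (ν : PMF Θ) : ℝ :=
  ∑ θ, (ν θ).toReal * receiverUtil uR p θ

/-- `p` is a best response of the receiver, among all mixed actions, to the belief `ν`. -/
def IsBestResponse {Θ A : Type*} [Fintype Θ] [Fintype A] (uR : A → Θ → ℝ)
    (p : PMF A) (ν : PMF Θ) : Prop :=
  ∀ q : PMF A, receiverExp uR q ν ≤ receiverExp uR p ν

/-- Candidate equilibria: perfect Bayesian equilibria of the game with prior `μ`, transparent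
sender utility `u0` and receiver utility `uR`. -/
structure IsCandidateEq {Θ A M : Type*} [Fintype Θ] [Fintype A] (μ : PMF Θ) (u0 : A → M → ℝ)
    (uR : A → Θ → ℝ) (σ : Profile Θ A M) : Prop where
  /-- every message sent in some state maximizes the sender's utility over all messages -/
  sender : ∀ θ, ∀ m ∈ (σ.send θ).support, ∀ m2,
    senderUtil u0 (σ.act m2) m2 ≤ senderUtil u0 (σ.act m) m
  /-- Bayes' rule; `μ.bind σ.send` is the law of the message, and the equation reads `0 = 0`
  for a message that is sent with probability zero, whose belief is thus unrestricted -/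
  bayes : ∀ m θ, σ.belief m θ * (μ.bind σ.send) m = μ θ * σ.send θ m
  /-- the receiver best-responds to the belief after every message, on or off path -/
  receiver : ∀ m, IsBestResponse uR (σ.act m) (σ.belief m)

/-- The sender is never indifferent between messages that lead to different pure actions. -/
def AssumptionS {A M : Type*} (u0 : A → M → ℝ) : Prop :=
  ∀ a b : A, a ≠ b → ∀ m n : M, u0 a m ≠ u0 b n

/-- Any two distinct pure best responses to a belief give the receiver different utilities
in some state of the support of that belief. -/
def AssumptionR {Θ A : Type*} [Fintype Θ] [Fintype A] (uR : A → Θ → ℝ) : Prop :=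
  ∀ (ν : PMF Θ) (a b : A), a ≠ b →
    IsBestResponse uR (PMF.pure a) ν → IsBestResponse uR (PMF.pure b) ν →
    ∃ θ ∈ ν.support, uR a θ ≠ uR b θ

/-- For any three (possibly non-distinct) pure best responses to a belief, distinct mixtures of
them are distinguished by the receiver in some state of the support of that belief. -/
def AssumptionRStar {Θ A : Type*} [Fintype Θ] [Fintype A] (uR : A → Θ → ℝ) : Prop :=
  ∀ (ν : PMF Θ) (a b c : A),
    IsBestResponse uR (PMF.pure a) ν → IsBestResponse uR (PMF.pure b) ν →
    IsBestResponse uR (PMF.pure c) ν →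
    ∀ p q : PMF A, p.support ⊆ {a, b, c} → q.support ⊆ {a, b, c} →
      (∀ θ ∈ ν.support, receiverUtil uR p θ = receiverUtil uR q θ) → p = q

namespace Profile

variable {Θ A M : Type*}

/-- The equilibrium paths of state `θ`: the action-message pairs that occur in that state. -/
def paths (σ : Profile Θ A M) (θ : Θ) : Set (PMF A × M) :=
  {π | π.2 ∈ (σ.send θ).support ∧ π.1 = σ.act π.2}

/-- All equilibrium paths. -/
def onPath (σ : Profile Θ A M) : Set (PMF A × M) :=
  ⋃ θ, σ.paths θ

/-- The communication graph: the bipartite graph on the states and the equilibrium paths, where a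
state is joined to the paths that occur in it. -/
def commGraph (σ : Profile Θ A M) : SimpleGraph (Θ ⊕ σ.onPath) where
  Adj x y := (∃ (θ : Θ) (π : σ.onPath), x = Sum.inl θ ∧ y = Sum.inr π ∧ π.1 ∈ σ.paths θ) ∨
    ∃ (θ : Θ) (π : σ.onPath), y = Sum.inl θ ∧ x = Sum.inr π ∧ π.1 ∈ σ.paths θ
  symm := ⟨fun _ _ h => h.symm⟩
  loopless := ⟨by
    rintro x (⟨θ, π, h1, h2, -⟩ | ⟨θ, π, h1, h2, -⟩) <;> rw [h1] at h2 <;> cases h2⟩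

/-- No two different on-path messages recommend the same pure action. -/
def Irredundant (σ : Profile Θ A M) : Prop :=
  ∀ (a : A) (m n : M), (PMF.pure a, m) ∈ σ.onPath → (PMF.pure a, n) ∈ σ.onPath → m = n

/-- The distribution of the receiver's posterior belief under the prior `μ`. -/
noncomputable def posteriorLaw (σ : Profile Θ A M) (μ : PMF Θ) : PMF (PMF Θ) :=
  (μ.bind σ.send).map σ.belief

/-- Two profiles have the same communication graph, up to renaming messages: there is a graph
isomorphism that fixes each state and preserves the action of each equilibrium path. -/
def SameGraph (σ τ : Profile Θ A M) : Prop :=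
  ∃ e : σ.onPath ≃ τ.onPath, ∀ π : σ.onPath,
    (e π).1.1 = π.1.1 ∧ ∀ θ, π.1 ∈ σ.paths θ ↔ (e π).1 ∈ τ.paths θ

end Profile

/-- (a) No irredundant candidate equilibrium is a forest (acyclic but not connected). -/
def NoForestEq {Θ A M : Type*} [Fintype Θ] [Fintype A] (μ : PMF Θ) (u0 : A → M → ℝ)
    (uR : A → Θ → ℝ) : Prop :=
  ¬ ∃ σ : Profile Θ A M, IsCandidateEq μ u0 uR σ ∧ σ.Irredundant ∧
    σ.commGraph.IsAcyclic ∧ ¬ σ.commGraph.Connected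

/-- (b) Every acyclic candidate equilibrium uses exactly one pure action. -/
def OnePureAction {Θ A M : Type*} [Fintype Θ] [Fintype A] (μ : PMF Θ) (u0 : A → M → ℝ)
    (uR : A → Θ → ℝ) : Prop :=
  ∀ σ : Profile Θ A M, IsCandidateEq μ u0 uR σ → σ.commGraph.IsAcyclic →
    ∃! a : A, ∃ m : M, (PMF.pure a, m) ∈ σ.onPath

/-- (c) All mixed actions in irredundant acyclic candidate equilibria are binary. -/
def MixedActionsBinary {Θ A M : Type*} [Fintype Θ] [Fintype A] (μ : PMF Θ) (u0 : A → M → ℝ)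
    (uR : A → Θ → ℝ) : Prop :=
  ∀ σ : Profile Θ A M, IsCandidateEq μ u0 uR σ → σ.Irredundant → σ.commGraph.IsAcyclic →
    ∀ π ∈ σ.onPath, (¬ ∃ a : A, π.1 = PMF.pure a) → π.1.support.ncard = 2

/-- (d) Up to information equivalence (equality of the distributions of posterior beliefs) there
are finitely many irredundant acyclic candidate equilibria, and each of them is identified by its
communication graph. -/
def FinitelyManyIdentified {Θ A M : Type*} [Fintype Θ] [Fintype A] (μ : PMF Θ) (u0 : A → M → ℝ)
    (uR : A → Θ → ℝ) : Prop :=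
  {L : PMF (PMF Θ) | ∃ σ : Profile Θ A M, IsCandidateEq μ u0 uR σ ∧ σ.Irredundant ∧
    σ.commGraph.IsAcyclic ∧ σ.posteriorLaw μ = L}.Finite ∧
  ∀ σ τ : Profile Θ A M,
    IsCandidateEq μ u0 uR σ → σ.Irredundant → σ.commGraph.IsAcyclic →
    IsCandidateEq μ u0 uR τ → τ.Irredundant → τ.commGraph.IsAcyclic →
    σ.SameGraph τ → σ.posteriorLaw μ = τ.posteriorLaw μ

/-- `P` holds for Lebesgue-almost every prior in the simplex `Δ Θ`. A set of priors is null for the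
`(|Θ| - 1)`-dimensional Lebesgue measure of the simplex iff the open cone over its relatively
interior part is Lebesgue null in `ℝ^Θ`; the exceptional set is measured through that cone, a
positive weight vector `w` standing for the prior `w / ∑ w`. -/
def ForGenericPrior {Θ : Type*} [Fintype Θ] (P : PMF Θ → Prop) : Prop :=
  ∀ᵐ w : Θ → ℝ, (∀ θ, 0 < w θ) →
    ∀ μ : PMF Θ, (∀ θ, (μ θ).toReal = w θ / ∑ i, w i) → P μ

/-!
The heart of the argument is a dimension count. Write `x_m(θ) = μ(θ) · 𝓜(m | θ)` for the joint
weight of state and message (`Profile.flow`). In an equilibrium the vector `x_m` is supported on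
the set `N_m` of states that send `m`, and, because every action in the support of the receiver's
reply is a best response to the posterior, it annihilates `u_R(a|·) - u_R(b|·)` for all `a`, `b` in
the support `S_m` of the reply. These conditions cut out a subspace `indifference u_R N_m S_m` of
`ℝ^Θ` that depends only on the supports, and the prior is `∑_m x_m`, so it lies in the sum of
these subspaces.

There are only countably many families of supports, and a proper subspace is Lebesgue null. Hence a
generic prior lies in such a sum only if the sum is all of `ℝ^Θ` (`IsGenericPair`). For a fixed
prior and generic `u_R` the same holds by Fubini, since only the products `μ(θ) u_R(a|θ)` enter
the equations: null sets of pairs have null slices at some prior, and rescaling moves that prior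
to the given one (`ae_isGenericPair_of_pos`).

So in a generic equilibrium `|Θ| ≤ ∑_m dim (indifference u_R N_m S_m)`. By (R) each mixed reply
costs at least one dimension, by (R*) a reply with three or more actions costs two, so the sum is at
most `|E| - #mixed - #(non-binary mixed)`, where `|E| = ∑_m |N_m|` is the number of edges of the
communication graph. For an acyclic graph with `c` components and `k` messages
`|E| = |Θ| + k - c`. Therefore `#pure ≥ c + #(non-binary mixed)`. Assumption (S) allows one pure
action on path, and irredundance then allows one pure message, which gives (a), (b) and (c). Under
irredundance the dimensions add up to exactly `|Θ|`, so the sum of subspaces is direct: the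
supports determine every `x_m` and with them the distribution of posteriors. As acyclicity bounds
the number of messages, there are finitely many supports, which gives (d).

Finally (R*) itself holds for almost every `u_R` (`ae_assumptionRStar`): it suffices that the
payoffs of distinct actions differ in each state and that, for distinct actions `a`, `b`, `c`, the
vectors `u_R(a|·) - u_R(b|·)` and `u_R(a|·) - u_R(c|·)` are independent on each pair of states.
-/

/-! ### Indifference subspaces and generic pairs -/

/-- The weights on states that vanish outside `N` and under which the receiver is indifferent between
all actions in `S`. The weights are neither normalized nor required to be nonnegative, so that they
form a subspace. -/
def indifference {Θ A : Type*} [Fintype Θ] (u : A → Θ → ℝ) (N : Finset Θ) (S : Finset A) :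
    Submodule ℝ (Θ → ℝ) where
  carrier := {x | (∀ θ ∉ N, x θ = 0) ∧ ∀ a ∈ S, ∀ b ∈ S, ∑ θ, x θ * (u a θ - u b θ) = 0}
  zero_mem' := by simp
  add_mem' := by
    rintro x y ⟨hx, hx'⟩ ⟨hy, hy'⟩
    refine ⟨fun θ h => by simp [hx θ h, hy θ h], fun a ha b hb => ?_⟩
    simp [add_mul, Finset.sum_add_distrib, hx' a ha b hb, hy' a ha b hb]
  smul_mem' := by
    rintro c x ⟨hx, hx'⟩
    refine ⟨fun θ h => by simp [hx θ h], fun a ha b hb => ?_⟩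
    simp [mul_assoc, ← Finset.mul_sum, hx' a ha b hb]

theorem mem_indifference {Θ A : Type*} [Fintype Θ] {u : A → Θ → ℝ} {N : Finset Θ} {S : Finset A}
    {x : Θ → ℝ} : x ∈ indifference u N S ↔ (∀ θ ∉ N, x θ = 0) ∧
      ∀ a ∈ S, ∀ b ∈ S, ∑ θ, x θ * (u a θ - u b θ) = 0 := Iff.rfl

/-- Payoff differences of actions in `S` that are linearly independent on `N` each cost one dimension
of the `#N` available ones. -/
theorem finrank_indifference_add_le {Θ A : Type*} [Fintype Θ] (u : A → Θ → ℝ) (N : Finset Θ)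
    (S : Finset A) {r : ℕ} (d : Fin r → Θ → ℝ)
    (hli : LinearIndependent ℝ fun j (θ : N) => d j θ)
    (hd : ∀ j, ∃ a ∈ S, ∃ b ∈ S, ∀ θ, d j θ = u a θ - u b θ) :
    Module.finrank ℝ (indifference u N S) + r ≤ N.card := by
  classical
  let M : Matrix (Fin r) N ℝ := Matrix.of fun j θ => d j θ
  have hM : M.rank = r := by
    have : LinearIndependent ℝ M.row := hli
    simpa using this.rank_matrix
  have hker := LinearMap.finrank_range_add_finrank_ker M.mulVecLin
  have hM' : Module.finrank ℝ (LinearMap.range M.mulVecLin) = r := hM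
  rw [hM', Module.finrank_fintype_fun_eq_card, Fintype.card_coe] at hker
  let R : (Θ → ℝ) →ₗ[ℝ] (N → ℝ) := LinearMap.funLeft ℝ ℝ Subtype.val
  have hR : ∀ x ∈ indifference u N S, R x ∈ LinearMap.ker M.mulVecLin := by
    intro x hx
    rw [mem_indifference] at hx
    ext j
    obtain ⟨a, ha, b, hb, h⟩ := hd j
    have h2 := hx.2 a ha b hb
    rw [← Finset.sum_subset (Finset.subset_univ N)
      (fun θ _ hθ => by simp [hx.1 θ hθ]), ← Finset.sum_coe_sort] at h2
    simp only [Matrix.mulVecLin_apply, Matrix.mulVec, dotProduct, Pi.zero_apply]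
    rw [← h2]
    refine Finset.sum_congr rfl fun θ _ => ?_
    simp [M, R, h, mul_comm, LinearMap.funLeft_apply]
  have hinj : Function.Injective (R.restrict hR) := by
    rintro ⟨x, hx⟩ ⟨y, hy⟩ h
    ext θ
    by_cases hθ : θ ∈ N
    · have := congrFun (congrArg Subtype.val h) ⟨θ, hθ⟩
      simpa [R, LinearMap.funLeft_apply] using this
    · simp [hx.1 θ hθ, hy.1 θ hθ]
  have := LinearMap.finrank_le_finrank_of_injective hinj
  omega

/-- The weight vector `w` lies in a finite sum of indifference subspaces of `u` only if that sum is
the whole space. The families are indexed by `Fin k` so that there are countably many of them. -/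
def IsGenericPair {Θ A : Type*} [Fintype Θ] (u : A → Θ → ℝ) (w : Θ → ℝ) : Prop :=
  ∀ (k : ℕ) (N : Fin k → Finset Θ) (S : Fin k → Finset A),
    w ∈ ⨆ i, indifference u (N i) (S i) → ⨆ i, indifference u (N i) (S i) = ⊤

theorem ae_isGenericPair {Θ A : Type*} [Fintype Θ] [Fintype A] (u : A → Θ → ℝ) :
    ∀ᵐ w : Θ → ℝ, IsGenericPair u w := by
  classical
  simp only [IsGenericPair, ae_all_iff]
  intro k N S
  by_cases h : ⨆ i, indifference u (N i) (S i) = ⊤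
  · simp [h]
  · have := Measure.addHaar_submodule (volume : Measure (Θ → ℝ)) _ h
    filter_upwards [measure_eq_zero_iff_ae_notMem.1 this] with w hw hw'
    exact absurd hw' hw

/-- The set is the image of a closed set under a continuous map, hence σ-compact. -/
theorem measurableSet_mem_iSup_indifference {Θ A : Type*} [Fintype Θ] [Fintype A] {k : ℕ}
    (N : Fin k → Finset Θ) (S : Fin k → Finset A) :
    MeasurableSet {z : (A → Θ → ℝ) × (Θ → ℝ) | z.2 ∈ ⨆ i, indifference z.1 (N i) (S i)} := by
  classical
  let C : Set ((A → Θ → ℝ) × (Fin k → Θ → ℝ)) :=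
    {z | ∀ i, (∀ θ ∉ N i, z.2 i θ = 0) ∧
      ∀ a ∈ S i, ∀ b ∈ S i, ∑ θ, z.2 i θ * (z.1 a θ - z.1 b θ) = 0}
  have hC : IsClosed C := by
    simp only [C, Set.ofPred_forall, Set.ofPred_and]
    refine isClosed_iInter fun i => IsClosed.inter ?_ ?_
    · refine isClosed_iInter fun θ => isClosed_iInter fun _ => isClosed_eq ?_ ?_ <;> fun_prop
    · refine isClosed_iInter fun a => isClosed_iInter fun _ => isClosed_iInter fun b =>
        isClosed_iInter fun _ => isClosed_eq ?_ ?_ <;> fun_prop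
  let g : (A → Θ → ℝ) × (Fin k → Θ → ℝ) → (A → Θ → ℝ) × (Θ → ℝ) := fun z => (z.1, ∑ i, z.2 i)
  have hg : Continuous g := by fun_prop
  have heq : {z : (A → Θ → ℝ) × (Θ → ℝ) | z.2 ∈ ⨆ i, indifference z.1 (N i) (S i)} = g '' C := by
    ext ⟨u, w⟩
    simp only [Set.mem_ofPred_eq, Set.mem_image, Submodule.mem_iSup_iff_exists_finsupp]
    constructor
    · rintro ⟨f, hf, hw⟩
      refine ⟨(u, f), fun i => hf i, ?_⟩
      rw [← hw, Finsupp.sum_fintype _ _ (fun _ => rfl)]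
    · rintro ⟨⟨u', x⟩, hx, h⟩
      simp only [g, Prod.mk.injEq] at h
      obtain ⟨rfl, h⟩ := h
      refine ⟨Finsupp.equivFunOnFinite.symm x, fun i => hx i, ?_⟩
      rw [Finsupp.sum_fintype _ _ (fun _ => rfl)]
      simpa using h
  rw [heq]
  obtain ⟨K, hK, hK'⟩ : IsSigmaCompact (g '' C) :=
    (isSigmaCompact_univ.of_isClosed_subset hC (Set.subset_univ C)).image hg
  rw [← hK']
  exact MeasurableSet.iUnion fun n => (hK n).measurableSet

theorem measurableSet_isGenericPair {Θ A : Type*} [Fintype Θ] [Fintype A] :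
    MeasurableSet {z : (A → Θ → ℝ) × (Θ → ℝ) | IsGenericPair z.1 z.2} := by
  classical
  simp only [IsGenericPair, Set.ofPred_forall]
  refine MeasurableSet.iInter fun k => MeasurableSet.iInter fun N => MeasurableSet.iInter fun S => ?_
  have h := measurableSet_mem_iSup_indifference N S
  have htop : ∀ V : Submodule ℝ (Θ → ℝ), V = ⊤ ↔ ∀ θ, Pi.single θ (1 : ℝ) ∈ V := by
    intro V
    refine ⟨fun h => by simp [h], fun h => ?_⟩
    rw [eq_top_iff, ← (Pi.basisFun ℝ Θ).span_eq, Submodule.span_le]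
    rintro _ ⟨θ, rfl⟩
    simpa using h θ
  simp only [imp_iff_not_or, Set.ofPred_or]
  refine h.compl.union ?_
  simp only [htop, Set.ofPred_forall]
  refine MeasurableSet.iInter fun θ => ?_
  exact h.preimage (f := fun z : (A → Θ → ℝ) × (Θ → ℝ) => (z.1, Pi.single θ (1 : ℝ))) (by fun_prop)

/-- Indifference depends on weights and payoffs only through their product in each state. -/
theorem IsGenericPair.rescale {Θ A : Type*} [Fintype Θ] {u : A → Θ → ℝ} {w : Θ → ℝ}
    (h : IsGenericPair u w) {r : Θ → ℝ} (hr : ∀ θ, r θ ≠ 0) :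
    IsGenericPair (fun a θ => r θ * u a θ) (fun θ => w θ / r θ) := by
  classical
  let D : (Θ → ℝ) ≃ₗ[ℝ] (Θ → ℝ) :=
    LinearEquiv.piCongrRight fun θ => LinearEquiv.smulOfNeZero ℝ ℝ (r θ) (hr θ)
  have hD : ∀ x θ, D x θ = r θ * x θ := fun x θ => rfl
  have hW : ∀ N S, indifference (fun a θ => r θ * u a θ) N S =
      (indifference u N S).comap D.toLinearMap := by
    intro N S
    ext x
    simp only [Submodule.mem_comap, mem_indifference, LinearEquiv.coe_coe, hD, mul_eq_zero, hr,
      false_or]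
    refine and_congr_right fun _ => ?_
    simp only [← mul_sub, mul_left_comm, mul_assoc]
  intro k N S
  have hsup : ⨆ i, indifference (fun a θ => r θ * u a θ) (N i) (S i) =
      (⨆ i, indifference u (N i) (S i)).comap D.toLinearMap := by
    simp only [hW, Submodule.comap_equiv_eq_map_symm, Submodule.map_iSup]
  rw [hsup]
  intro hw
  rw [Submodule.mem_comap] at hw
  have hDw : D.toLinearMap (fun θ => w θ / r θ) = w := by
    ext θ
    simp only [LinearEquiv.coe_coe, hD]
    field_simp [hr θ]
  rw [hDw] at hw
  rw [h k N S hw, Submodule.comap_top]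

/-- By Fubini some weight vector `v` with nonzero entries is generic for almost every `u`; rescaling
the states carries `v` to `w` and preserves null sets of payoffs. -/
theorem ae_isGenericPair_of_pos {Θ A : Type*} [Fintype Θ] [Fintype A] (w : Θ → ℝ)
    (hw : ∀ θ, 0 < w θ) : ∀ᵐ u : A → Θ → ℝ, IsGenericPair u w := by
  classical
  have h1 : ∀ᵐ z : (A → Θ → ℝ) × (Θ → ℝ), IsGenericPair z.1 z.2 :=
    (Measure.ae_prod_iff_ae_ae measurableSet_isGenericPair).2
      (Filter.Eventually.of_forall ae_isGenericPair)
  have h2 : ∀ᵐ v : Θ → ℝ, ∀ᵐ u : A → Θ → ℝ, IsGenericPair u v := by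
    have := Measure.ae_ae_of_ae_prod (Measure.measurePreserving_swap.quasiMeasurePreserving.ae h1)
    exact this
  have h3 : ∀ᵐ v : Θ → ℝ, ∀ θ, v θ ≠ 0 := by
    rw [ae_all_iff]
    intro θ
    have hne : LinearMap.ker (LinearMap.proj (R := ℝ) (φ := fun _ : Θ => ℝ) θ) ≠ ⊤ := by
      intro h
      have : (fun _ => 1 : Θ → ℝ) ∈
          LinearMap.ker (LinearMap.proj (R := ℝ) (φ := fun _ : Θ => ℝ) θ) := by
        rw [h]; trivial
      simp at this
    exact measure_eq_zero_iff_ae_notMem.1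
      (Measure.addHaar_submodule (volume : Measure (Θ → ℝ)) _ hne)
  obtain ⟨v, hv, hv0⟩ := (h2.and h3).exists
  let r : Θ → ℝ := fun θ => v θ / w θ
  have hr : ∀ θ, r θ ≠ 0 := fun θ => div_ne_zero (hv0 θ) (hw θ).ne'
  let T : (A → Θ → ℝ) ≃ₗ[ℝ] (A → Θ → ℝ) := LinearEquiv.piCongrRight fun _ =>
    LinearEquiv.piCongrRight fun θ => LinearEquiv.smulOfNeZero ℝ ℝ (r θ) (hr θ)
  have hq := Measure.LinearMap.quasiMeasurePreserving (volume : Measure (A → Θ → ℝ))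
    T.symm.toLinearMap
    (LinearEquiv.isUnit_det' T.symm).ne_zero
  filter_upwards [hq.ae hv] with u hu
  have := hu.rescale hr
  have e1 : (fun a θ => r θ * (T.symm.toLinearMap u) a θ) = u := T.apply_symm_apply u
  have e2 : (fun θ => v θ / r θ) = w := by
    ext θ
    simp only [r]
    field_simp [hv0 θ, (hw θ).ne']
  rwa [e1, e2] at this

/-! ### Best responses and conditions (R), (R*) -/

theorem PMF.sum_toReal_eq_one {α : Type*} [Fintype α] (p : PMF α) : ∑ a, (p a).toReal = 1 := by
  have h := p.tsum_coe
  rw [tsum_fintype] at h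
  rw [← ENNReal.toReal_sum fun a _ => p.apply_ne_top a, h, ENNReal.toReal_one]

theorem PMF.toReal_eq_zero_iff {α : Type*} (p : PMF α) (a : α) :
    (p a).toReal = 0 ↔ a ∉ p.support := by
  simp [ENNReal.toReal_eq_zero_iff, p.apply_ne_top a, PMF.mem_support_iff]

theorem PMF.ext_toReal {α : Type*} {p q : PMF α} (h : ∀ a, (p a).toReal = (q a).toReal) : p = q :=
  PMF.ext fun a => (ENNReal.toReal_eq_toReal_iff' (p.apply_ne_top a) (q.apply_ne_top a)).1 (h a)

theorem receiverUtil_pure {Θ A : Type*} [Fintype A] (u : A → Θ → ℝ) (a : A) (θ : Θ) :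
    receiverUtil u (PMF.pure a) θ = u a θ := by
  classical
  rw [receiverUtil, Finset.sum_eq_single a] <;> simp +contextual [PMF.pure_apply]

theorem receiverExp_eq_sum {Θ A : Type*} [Fintype Θ] [Fintype A] (u : A → Θ → ℝ) (p : PMF A)
    (ν : PMF Θ) : receiverExp u p ν = ∑ a, (p a).toReal * receiverExp u (PMF.pure a) ν := by
  simp only [receiverExp, receiverUtil_pure]
  simp only [receiverUtil, Finset.mul_sum]
  rw [Finset.sum_comm]
  simp only [mul_left_comm]

theorem IsBestResponse.receiverExp_pure_eq {Θ A : Type*} [Fintype Θ] [Fintype A] {u : A → Θ → ℝ}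
    {p : PMF A} {ν : PMF Θ} (h : IsBestResponse u p ν) {a : A} (ha : a ∈ p.support) :
    receiverExp u (PMF.pure a) ν = receiverExp u p ν := by
  have hnn : ∀ b ∈ Finset.univ,
      0 ≤ (p b).toReal * (receiverExp u p ν - receiverExp u (PMF.pure b) ν) := fun b _ =>
    mul_nonneg ENNReal.toReal_nonneg (sub_nonneg.2 (h _))
  have hsum : ∑ b, (p b).toReal * (receiverExp u p ν - receiverExp u (PMF.pure b) ν) = 0 := by
    simp only [mul_sub, Finset.sum_sub_distrib, ← Finset.sum_mul, p.sum_toReal_eq_one, one_mul,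
      ← receiverExp_eq_sum, sub_self]
  rcases mul_eq_zero.1 ((Finset.sum_eq_zero_iff_of_nonneg hnn).1 hsum a (Finset.mem_univ a))
    with h0 | h0
  · exact absurd ha ((p.toReal_eq_zero_iff a).1 h0)
  · linarith

theorem IsBestResponse.pure_of_mem_support {Θ A : Type*} [Fintype Θ] [Fintype A] {u : A → Θ → ℝ}
    {p : PMF A} {ν : PMF Θ} (h : IsBestResponse u p ν) {a : A} (ha : a ∈ p.support) :
    IsBestResponse u (PMF.pure a) ν := fun q => by
  rw [h.receiverExp_pure_eq ha]; exact h q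

theorem AssumptionRStar.assumptionR {Θ A : Type*} [Fintype Θ] [Fintype A] {u : A → Θ → ℝ}
    (h : AssumptionRStar u) : AssumptionR u := by
  classical
  intro ν a b hab ha hb
  by_contra! hc
  have := h ν a b b ha hb hb (PMF.pure a) (PMF.pure b) (by simp) (by simp)
    (by simpa only [receiverUtil_pure] using hc)
  have h2 := congrArg (fun p => a ∈ p.support) this
  simp [hab] at h2

/-- A linear relation between the two payoff differences, scaled down and added to the uniform
distribution on `{a, b, c}`, gives a second distribution that is payoff equivalent on `N`. -/
theorem AssumptionRStar.linearIndependent {Θ A : Type*} [Fintype Θ] [Fintype A] {u : A → Θ → ℝ}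
    (h : AssumptionRStar u) {ν : PMF Θ} {a b c : A} (hab : a ≠ b) (hac : a ≠ c) (hbc : b ≠ c)
    (ha : IsBestResponse u (PMF.pure a) ν) (hb : IsBestResponse u (PMF.pure b) ν)
    (hc : IsBestResponse u (PMF.pure c) ν) {N : Finset Θ} (hN : ∀ θ, θ ∈ N ↔ θ ∈ ν.support) :
    LinearIndependent ℝ fun (j : Fin 2) (θ : N) =>
      (![fun θ => u a θ - u b θ, fun θ => u a θ - u c θ] : Fin 2 → Θ → ℝ) j θ := by
  classical
  have hpair : LinearIndependent ℝ ![fun θ : N => u a θ - u b θ, fun θ : N => u a θ - u c θ] := by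
    rw [LinearIndependent.pair_iff]
    intro s t hst
    -- small enough for the perturbed weights below to stay nonnegative
    let ε : ℝ := 1 / (3 * (|s| + |t| + 1))
    have hpos : 0 < |s| + |t| + 1 := by positivity
    have hε : 0 < ε := by positivity
    have hεb : ε * (|s| + |t|) ≤ 1 / 3 := by
      have : ε * (|s| + |t| + 1) = 1 / 3 := by simp only [ε]; field_simp
      nlinarith
    let f : ℝ → ℝ → ℝ → A → ℝ := fun x y z i =>
      if i = a then x else if i = b then y else if i = c then z else 0
    have hfa : ∀ x y z, f x y z a = x := fun x y z => by simp [f]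
    have hfb : ∀ x y z, f x y z b = y := fun x y z => by simp [f, hab.symm]
    have hfc : ∀ x y z, f x y z c = z := fun x y z => by simp [f, hac.symm, hbc.symm]
    have hfsum : ∀ x y z (v : A → ℝ), ∑ i, f x y z i * v i = x * v a + y * v b + z * v c := by
      intro x y z v
      have : ∑ i ∈ ({a, b, c} : Finset A), f x y z i * v i = ∑ i, f x y z i * v i := by
        refine Finset.sum_subset (Finset.subset_univ _) fun i _ hi => ?_
        simp only [Finset.mem_insert, Finset.mem_singleton, not_or] at hi
        simp [f, hi.1, hi.2.1, hi.2.2]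
      rw [← this, Finset.sum_insert (by simp [hab, hac]), Finset.sum_insert (by simp [hbc]),
        Finset.sum_singleton, hfa, hfb, hfc, add_assoc]
    have key : ∀ x y z, 0 ≤ x → 0 ≤ y → 0 ≤ z → x + y + z = 1 → ∃ p : PMF A,
        p.support ⊆ {a, b, c} ∧ ∀ i, (p i).toReal = f x y z i := by
      intro x y z hx hy hz hxyz
      have hnn : ∀ i, 0 ≤ f x y z i := by
        intro i
        simp only [f]
        split_ifs <;> first | assumption | exact le_rfl
      refine ⟨PMF.ofFintype (fun i => ENNReal.ofReal (f x y z i)) ?_, ?_, ?_⟩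
      · rw [← ENNReal.ofReal_sum_of_nonneg fun i _ => hnn i]
        have := hfsum x y z (fun _ => 1)
        simp only [mul_one] at this
        rw [this, hxyz, ENNReal.ofReal_one]
      · intro i hi
        by_contra hc
        simp only [Set.mem_insert_iff, Set.mem_singleton_iff, not_or] at hc
        simp [f, hc.1, hc.2.1, hc.2.2] at hi
      · intro i
        rw [PMF.ofFintype_apply, ENNReal.toReal_ofReal (hnn i)]
    have hs := abs_le.1 (le_refl |s|)
    have ht := abs_le.1 (le_refl |t|)
    obtain ⟨p, hp, hp'⟩ := key (1 / 3 + ε * (s + t)) (1 / 3 - ε * s) (1 / 3 - ε * t)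
      (by nlinarith) (by nlinarith [abs_nonneg t]) (by nlinarith [abs_nonneg s]) (by ring)
    obtain ⟨q, hq, hq'⟩ := key (1 / 3) (1 / 3) (1 / 3) (by norm_num) (by norm_num) (by norm_num)
      (by norm_num)
    have hpq := h ν a b c ha hb hc p q hp hq fun θ hθ => by
      simp only [receiverUtil, hp', hq', hfsum]
      have := congrFun hst ⟨θ, (hN θ).2 hθ⟩
      simp only [Pi.add_apply, Pi.smul_apply, smul_eq_mul, Pi.zero_apply] at this
      linear_combination ε * this
    have e1 := hp' b
    have e2 := hp' c
    rw [hpq, hq', hfb, hfb] at e1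
    rw [hpq, hq', hfc, hfc] at e2
    constructor
    · exact (mul_eq_zero.1 (by linarith : ε * s = 0)).resolve_left hε.ne'
    · exact (mul_eq_zero.1 (by linarith : ε * t = 0)).resolve_left hε.ne'
  convert hpair using 1
  ext j θ
  fin_cases j <;> rfl

theorem AssumptionR.linearIndependent {Θ A : Type*} [Fintype Θ] [Fintype A] {u : A → Θ → ℝ}
    (h : AssumptionR u) {ν : PMF Θ} {a b : A} (hab : a ≠ b)
    (ha : IsBestResponse u (PMF.pure a) ν) (hb : IsBestResponse u (PMF.pure b) ν)
    {N : Finset Θ} (hN : ∀ θ, θ ∈ N ↔ θ ∈ ν.support) :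
    LinearIndependent ℝ fun (_ : Fin 1) (θ : N) => u a θ - u b θ := by
  obtain ⟨θ, hθ, hne⟩ := h ν a b hab ha hb
  rw [linearIndependent_unique_iff]
  intro h0
  exact sub_ne_zero.2 hne (congrFun h0 ⟨θ, (hN θ).2 hθ⟩)

/-! ### Condition (R*) for generic payoffs -/

/-- If payoffs are in general position in the states `θ` and `θ'`, a signed combination of at most
three actions with total weight zero and zero payoff in both states is trivial. -/
theorem eq_zero_of_affine_relations {Θ A : Type*} [Fintype A] {u : A → Θ → ℝ}
    {θ θ' : Θ} (h1 : ∀ a b, a ≠ b → u a θ ≠ u b θ)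
    (h2 : ∀ a b c, a ≠ b → a ≠ c → b ≠ c →
      (u a θ - u b θ) * (u a θ' - u c θ') ≠ (u a θ' - u b θ') * (u a θ - u c θ))
    {a b c : A} {γ : A → ℝ} (hsupp : ∀ i, i ≠ a → i ≠ b → i ≠ c → γ i = 0) (hsum : ∑ i, γ i = 0)
    (hθ : ∑ i, γ i * u i θ = 0) (hθ' : ∑ i, γ i * u i θ' = 0) : γ = 0 := by
  classical
  have two : ∀ x y : A, (∀ i, i ≠ x → i ≠ y → γ i = 0) → γ = 0 := by
    intro x y hxy
    by_cases e : x = y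
    · subst e
      have : ∑ i, γ i = γ x := Finset.sum_eq_single x (fun i _ hi => hxy i hi hi) (by simp)
      ext i
      by_cases hi : i = x
      · rw [hi, ← this, hsum]; rfl
      · exact hxy i hi hi
    · have red : ∀ v : A → ℝ, ∑ i, γ i * v i = γ x * v x + γ y * v y := by
        intro v
        rw [← Finset.sum_subset (Finset.subset_univ {x, y}), Finset.sum_pair e]
        intro i _ hi
        simp only [Finset.mem_insert, Finset.mem_singleton, not_or] at hi
        simp [hxy i hi.1 hi.2]
      have e1 := red fun _ => 1
      have e2 := red fun i => u i θ
      simp only [mul_one, hsum] at e1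
      rw [hθ] at e2
      have hy : γ y = -γ x := by linarith
      have hx : γ x = 0 := by
        refine (mul_eq_zero.1 (?_ : γ x * (u x θ - u y θ) = 0)).resolve_right
          (sub_ne_zero.2 (h1 x y e))
        rw [hy] at e2; linarith
      ext i
      by_cases hi : i = x
      · rw [hi, hx]; rfl
      by_cases hi' : i = y
      · rw [hi', hy, hx, neg_zero]; rfl
      exact hxy i hi hi'
  by_cases hab : a = b
  · exact two b c fun i hi hi' => hsupp i (hab ▸ hi) hi hi'
  by_cases hac : a = c
  · exact two b c fun i hi hi' => hsupp i (hac ▸ hi') hi hi'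
  by_cases hbc : b = c
  · exact two a c fun i hi hi' => hsupp i hi (hbc ▸ hi') hi'
  have red : ∀ v : A → ℝ, ∑ i, γ i * v i = γ a * v a + γ b * v b + γ c * v c := by
    intro v
    rw [← Finset.sum_subset (Finset.subset_univ {a, b, c}), Finset.sum_insert (by simp [hab, hac]),
      Finset.sum_pair hbc, add_assoc]
    intro i _ hi
    simp only [Finset.mem_insert, Finset.mem_singleton, not_or] at hi
    simp [hsupp i hi.1 hi.2.1 hi.2.2]
  have e0 := red fun _ => 1
  have e1 := red fun i => u i θ
  have e2 := red fun i => u i θ'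
  simp only [mul_one, hsum] at e0
  rw [hθ] at e1
  rw [hθ'] at e2
  have ha : γ a = -γ b - γ c := by linarith
  rw [ha] at e1 e2
  -- Cramer's rule for the two remaining weights
  have hc : γ c = 0 := by
    refine (mul_eq_zero.1 (?_ : γ c * ((u a θ - u b θ) * (u a θ' - u c θ') -
      (u a θ' - u b θ') * (u a θ - u c θ)) = 0)).resolve_right
      (sub_ne_zero.2 (h2 a b c hab hac hbc))
    linear_combination (u a θ - u b θ) * (-1) * (-e2) + (u a θ' - u b θ') * (-e1)
  exact two a b fun i hi hi' => by
    by_cases h : i = c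
    · rw [h, hc]
    · exact hsupp i hi hi' h

theorem assumptionRStar_of_general_position {Θ A : Type*} [Fintype Θ] [Fintype A] {u : A → Θ → ℝ}
    (h1 : ∀ θ a b, a ≠ b → u a θ ≠ u b θ)
    (h2 : ∀ θ θ', θ ≠ θ' → ∀ a b c, a ≠ b → a ≠ c → b ≠ c →
      (u a θ - u b θ) * (u a θ' - u c θ') ≠ (u a θ' - u b θ') * (u a θ - u c θ)) :
    AssumptionRStar u := by
  classical
  intro ν a b c ha hb hc p q hp hq hpq
  obtain ⟨θ, hθ⟩ := ν.support_nonempty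
  have hzero : ∀ r : PMF A, r.support ⊆ {a, b, c} → ∀ i, i ≠ a → i ≠ b → i ≠ c →
      (r i).toReal = 0 := by
    intro r hr i h1 h2 h3
    rw [PMF.toReal_eq_zero_iff]
    intro hi
    simpa [h1, h2, h3] using hr hi
  by_cases hsing : ∃ θ' ∈ ν.support, θ ≠ θ'
  · obtain ⟨θ', hθ', hne⟩ := hsing
    have := eq_zero_of_affine_relations (γ := fun i => (p i).toReal - (q i).toReal)
      (h1 θ) (h2 θ θ' hne) (a := a) (b := b) (c := c)
      (fun i h1 h2 h3 => by simp [hzero p hp i h1 h2 h3, hzero q hq i h1 h2 h3])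
      (by simp [PMF.sum_toReal_eq_one])
      (by simpa [sub_mul, receiverUtil, sub_eq_zero] using hpq θ hθ)
      (by simpa [sub_mul, receiverUtil, sub_eq_zero] using hpq θ' hθ')
    exact PMF.ext_toReal fun i => sub_eq_zero.1 (congrFun this i)
  · -- at a degenerate belief the best response is unique
    push Not at hsing
    have hexp : ∀ x, receiverExp u (PMF.pure x) ν = (ν θ).toReal * u x θ := by
      intro x
      rw [receiverExp, Finset.sum_eq_single θ, receiverUtil_pure]
      · intro i _ hi
        rw [(ν.toReal_eq_zero_iff i).2 fun h => hi (hsing i h).symm, zero_mul]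
      · simp
    have hν : (ν θ).toReal ≠ 0 := by rw [Ne, PMF.toReal_eq_zero_iff, not_not]; exact hθ
    have huniq : ∀ x y, IsBestResponse u (PMF.pure x) ν → IsBestResponse u (PMF.pure y) ν →
        x = y := by
      intro x y hx hy
      by_contra hxy
      have := le_antisymm (hy (PMF.pure x)) (hx (PMF.pure y))
      rw [hexp, hexp] at this
      exact h1 θ x y hxy (mul_left_cancel₀ hν this)
    have hba := huniq b a hb ha
    have hca := huniq c a hc ha
    have hone : ∀ r : PMF A, r.support ⊆ {a, b, c} → ∀ i,
        (r i).toReal = if i = a then 1 else 0 := by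
      intro r hr i
      have hz : ∀ j, j ≠ a → (r j).toReal = 0 := fun j hj =>
        hzero r hr j hj (hba ▸ hj) (hca ▸ hj)
      split_ifs with hi
      · rw [hi, ← r.sum_toReal_eq_one]
        exact (Finset.sum_eq_single a (fun j _ hj => hz j hj) (by simp)).symm
      · exact hz i hi
    exact PMF.ext_toReal fun i => by rw [hone p hp, hone q hq]

theorem ae_assumptionRStar {Θ A : Type*} [Fintype Θ] [Fintype A] :
    ∀ᵐ u : A → Θ → ℝ, AssumptionRStar u := by
  classical
  have h1 : ∀ᵐ u : A → Θ → ℝ, ∀ θ a b, a ≠ b → u a θ ≠ u b θ := by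
    simp only [ae_all_iff]
    intro θ a b hab
    let φ : (A → Θ → ℝ) →ₗ[ℝ] ℝ :=
      (LinearMap.proj θ : (Θ → ℝ) →ₗ[ℝ] ℝ) ∘ₗ
        ((LinearMap.proj a : (A → Θ → ℝ) →ₗ[ℝ] Θ → ℝ) - LinearMap.proj b)
    have hφ : ∀ u, φ u = u a θ - u b θ := fun u => rfl
    have hne : LinearMap.ker φ ≠ ⊤ := by
      intro h
      have h2 : (fun i _ => if i = a then 1 else 0 : A → Θ → ℝ) ∈ LinearMap.ker φ := by
        rw [h]; trivial
      simp [hφ, hab.symm] at h2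
    filter_upwards [measure_eq_zero_iff_ae_notMem.1
      (Measure.addHaar_submodule (volume : Measure (A → Θ → ℝ)) _ hne)] with u hu h
    exact hu (LinearMap.mem_ker.2 (by rw [hφ, h, sub_self]))
  -- the first alternative is excluded almost surely by `h1`; it keeps the line argument simple
  have h2 : ∀ᵐ u : A → Θ → ℝ, ∀ θ θ', θ ≠ θ' → ∀ a b c, a ≠ b → a ≠ c → b ≠ c →
      (u a θ' = u c θ' ∨
      (u a θ - u b θ) * (u a θ' - u c θ') ≠ (u a θ' - u b θ') * (u a θ - u c θ)) := by
    simp only [ae_all_iff]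
    intro θ θ' hθ a b c hab hac hbc
    -- along the coordinate `u b θ` the two products differ by an affine function
    let L : ℝ →ₗ[ℝ] (A → Θ → ℝ) := LinearMap.toSpanSingleton ℝ _ (Pi.single b (Pi.single θ 1))
    have hL : ∀ t i j, L t i j = if i = b ∧ j = θ then t else 0 := by
      intro t i j
      simp only [L, LinearMap.toSpanSingleton_apply, Pi.smul_apply, Pi.single_apply, smul_eq_mul]
      by_cases hi : i = b <;> by_cases hj : j = θ <;> simp [hi, hj]
    refine ae_mem_of_ae_add_linearMap_mem L (μ := (volume : Measure ℝ))
      (ν := (volume : Measure (A → Θ → ℝ))) (s := {u | u a θ' = u c θ' ∨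
      (u a θ - u b θ) * (u a θ' - u c θ') ≠ (u a θ' - u b θ') * (u a θ - u c θ)}) ?_ ?_
    · refine (measurableSet_eq_fun (by fun_prop) (by fun_prop)).union ?_
      exact (measurableSet_eq_fun (by fun_prop) (by fun_prop)).compl
    · intro y
      by_cases hy : y a θ' = y c θ'
      · refine Filter.Eventually.of_forall fun t => Or.inl ?_
        simp [hL, hab, hbc.symm, hy]
      · have hy' : y a θ' - y c θ' ≠ 0 := sub_ne_zero.2 hy
        filter_upwards [Measure.ae_ne (volume : Measure ℝ) (y a θ - y b θ -
          (y a θ' - y b θ') * (y a θ - y c θ) / (y a θ' - y c θ'))] with t ht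
        refine Or.inr fun h => ht ?_
        simp only [Pi.add_apply, hL, hab, hbc.symm, hθ.symm, and_true, and_false, if_true, if_false,
          add_zero] at h
        field_simp
        linarith
  filter_upwards [h1, h2] with u hu1 hu2
  refine assumptionRStar_of_general_position hu1 fun θ θ' hθ a b c hab hac hbc => ?_
  exact (hu2 θ θ' hθ a b c hab hac hbc).resolve_left (hu1 θ' a c hac)

/-! ### Edges of forests and of communication graphs -/

theorem SimpleGraph.IsAcyclic.exists_isTree_ge {V : Type*} [Finite V] [Nonempty V]
    {G : SimpleGraph V} (h : G.IsAcyclic) : ∃ T, G ≤ T ∧ T.IsTree := by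
  obtain ⟨T, hGT, hT⟩ :=
    SimpleGraph.exists_maximal_isAcyclic_of_le_isAcyclic (H := G) (G := ⊤) le_top h
  refine ⟨T, hGT, ?_⟩
  exact (SimpleGraph.connected_top.maximal_le_isAcyclic_iff_isTree le_top).1 hT

theorem SimpleGraph.IsAcyclic.ncard_edgeSet_add_one_le {V : Type*} [Finite V] [Nonempty V]
    {G : SimpleGraph V} (h : G.IsAcyclic) : G.edgeSet.ncard + 1 ≤ Nat.card V := by
  classical
  have := Fintype.ofFinite V
  obtain ⟨T, hGT, hT⟩ := h.exists_isTree_ge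
  have h1 := hT.card_edgeFinset
  have h2 := Set.ncard_le_ncard (SimpleGraph.edgeSet_mono hGT) (Set.toFinite _)
  rw [← Set.ncard_coe_finset, SimpleGraph.coe_edgeFinset] at h1
  rw [Nat.card_eq_fintype_card]
  omega

theorem SimpleGraph.IsAcyclic.ncard_edgeSet_add_two_le {V : Type*} [Finite V] [Nonempty V]
    {G : SimpleGraph V} (h : G.IsAcyclic) (hc : ¬ G.Connected) :
    G.edgeSet.ncard + 2 ≤ Nat.card V := by
  classical
  have := Fintype.ofFinite V
  obtain ⟨T, hGT, hT⟩ := h.exists_isTree_ge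
  have h1 := hT.card_edgeFinset
  have hlt : G < T := lt_of_le_of_ne hGT fun h => hc (h ▸ hT.connected)
  have h2 := Set.ncard_lt_ncard (SimpleGraph.edgeSet_strict_mono hlt) (Set.toFinite _)
  rw [← Set.ncard_coe_finset, SimpleGraph.coe_edgeFinset] at h1
  rw [Nat.card_eq_fintype_card]
  omega

namespace Profile
variable {Θ A M : Type*}

theorem commGraph_adj (σ : Profile Θ A M) (θ : Θ) (π : σ.onPath) :
    σ.commGraph.Adj (Sum.inl θ) (Sum.inr π) ↔ π.1 ∈ σ.paths θ := by
  constructor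
  · rintro (⟨η, ρ, h1, h2, h⟩ | ⟨η, ρ, h1, h2, h⟩)
    · cases h1; cases h2; exact h
    · cases h1
  · exact fun h => Or.inl ⟨θ, π, rfl, rfl, h⟩

/-- In an acyclic communication graph two distinct equilibrium paths share at most one state, as they
would otherwise form a four-cycle. -/
theorem eq_of_common_states {σ : Profile Θ A M} (h : σ.commGraph.IsAcyclic) {θ θ' : Θ}
    (hne : θ ≠ θ') {π ρ : σ.onPath} (h1 : π.1 ∈ σ.paths θ) (h2 : π.1 ∈ σ.paths θ')
    (h3 : ρ.1 ∈ σ.paths θ) (h4 : ρ.1 ∈ σ.paths θ') : π = ρ := by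
  have key : ∀ π : σ.onPath, π.1 ∈ σ.paths θ → π.1 ∈ σ.paths θ' →
      ∃ p : σ.commGraph.Path (Sum.inl θ) (Sum.inl θ'), p.1.support =
        [Sum.inl θ, Sum.inr π, Sum.inl θ'] := by
    intro π h1 h2
    refine ⟨⟨.cons ((σ.commGraph_adj θ π).2 h1) (.cons ((σ.commGraph_adj θ' π).2 h2).symm .nil),
      ?_⟩, by simp⟩
    simp [SimpleGraph.Walk.isPath_def, hne]
  obtain ⟨p, hp⟩ := key π h1 h2
  obtain ⟨q, hq⟩ := key ρ h3 h4
  have := h.subsingleton_path (Sum.inl θ) (Sum.inl θ')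
  rw [Subsingleton.elim p q, hq] at hp
  simpa using hp.symm

theorem ncard_edgeSet_commGraph [Fintype Θ] (σ : Profile Θ A M) [Fintype σ.onPath] :
    σ.commGraph.edgeSet.ncard = ∑ π : σ.onPath, {θ | π.1 ∈ σ.paths θ}.ncard := by
  classical
  let f : (Σ π : σ.onPath, {θ // π.1 ∈ σ.paths θ}) → Sym2 (Θ ⊕ σ.onPath) := fun x =>
    s(Sum.inl x.2.1, Sum.inr x.1)
  have hf : Function.Injective f := by
    rintro ⟨π, θ, h⟩ ⟨ρ, η, h'⟩ hx
    simp [f] at hx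
    obtain ⟨rfl, rfl⟩ := hx
    rfl
  have hr : σ.commGraph.edgeSet = Set.range f := by
    ext e
    induction e with | _ x y
    rw [SimpleGraph.mem_edgeSet]
    constructor
    · rintro (⟨θ, π, rfl, rfl, h⟩ | ⟨θ, π, rfl, rfl, h⟩)
      · exact ⟨⟨π, θ, h⟩, rfl⟩
      · exact ⟨⟨π, θ, h⟩, Sym2.eq_swap⟩
    · rintro ⟨⟨π, θ, h⟩, hx⟩
      rw [← SimpleGraph.mem_edgeSet, ← hx]
      exact (σ.commGraph_adj θ π).2 h
  rw [hr, ← Set.image_univ, Set.ncard_image_of_injective _ hf, Set.ncard_univ, Nat.card_sigma]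
  rfl
end Profile

/-! ### Joint weights of states and messages -/

theorem IsGenericPair.smul {Θ A : Type*} [Fintype Θ] {u : A → Θ → ℝ} {w : Θ → ℝ}
    (h : IsGenericPair u w) {c : ℝ} (hc : c ≠ 0) : IsGenericPair u (c • w) := fun k N S hw =>
  h k N S ((Submodule.smul_mem_iff _ hc).1 hw)

/-- The map that adds up one vector from each subspace is onto when the subspaces span. -/
theorem exists_surjective_sum_of_iSup_eq_top {Θ : Type*} [Fintype Θ] {k : ℕ}
    (W : Fin k → Submodule ℝ (Θ → ℝ)) (hW : ⨆ i, W i = ⊤) :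
    ∃ L : (∀ i, W i) →ₗ[ℝ] (Θ → ℝ), (∀ x, L x = ∑ i, (x i : Θ → ℝ)) ∧ Function.Surjective L := by
  classical
  let L : (∀ i, W i) →ₗ[ℝ] (Θ → ℝ) := ∑ i, (W i).subtype ∘ₗ LinearMap.proj i
  have hL : ∀ x, L x = ∑ i, (x i : Θ → ℝ) := fun x => by simp [L, LinearMap.sum_apply]
  refine ⟨L, hL, ?_⟩
  rw [← LinearMap.range_eq_top, eq_top_iff, ← hW, iSup_le_iff]
  intro i x hx
  refine ⟨Pi.single i ⟨x, hx⟩, ?_⟩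
  rw [hL, Finset.sum_eq_single i]
  · simp
  · intro j _ hj
    simp [hj]
  · simp

namespace Profile
variable {Θ A M : Type*}

open Classical in
/-- The states in which the message `m` is sent with positive probability. -/
noncomputable def senders [Fintype Θ] (σ : Profile Θ A M) (m : M) : Finset Θ :=
  Finset.univ.filter fun θ => m ∈ (σ.send θ).support

open Classical in
/-- The support of the receiver's reply to the message `m`. -/
noncomputable def actions [Fintype A] (σ : Profile Θ A M) (m : M) : Finset A :=
  Finset.univ.filter fun a => a ∈ (σ.act m).support

/-- The joint probability of the state `θ` and the message `m`. -/
noncomputable def flow (σ : Profile Θ A M) (μ : PMF Θ) (m : M) (θ : Θ) : ℝ :=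
  (μ θ * σ.send θ m).toReal

theorem mem_senders [Fintype Θ] {σ : Profile Θ A M} {m : M} {θ : Θ} :
    θ ∈ σ.senders m ↔ m ∈ (σ.send θ).support := by simp [senders]

theorem mem_actions [Fintype A] {σ : Profile Θ A M} {m : M} {a : A} :
    a ∈ σ.actions m ↔ a ∈ (σ.act m).support := by simp [actions]

theorem act_of_onPath {σ : Profile Θ A M} {π : PMF A × M} (h : π ∈ σ.onPath) :
    π.1 = σ.act π.2 := by
  simp only [onPath, Set.mem_iUnion] at h
  exact h.choose_spec.2

theorem mem_paths_iff_mem_senders [Fintype Θ] {σ : Profile Θ A M} (π : σ.onPath) {θ : Θ} :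
    π.1 ∈ σ.paths θ ↔ θ ∈ σ.senders π.1.2 := by
  rw [mem_senders]
  exact ⟨fun h => h.1, fun h => ⟨h, act_of_onPath π.2⟩⟩

theorem exists_mem_senders [Fintype Θ] {σ : Profile Θ A M} (π : σ.onPath) :
    ∃ θ, θ ∈ σ.senders π.1.2 := by
  have h := π.2
  simp only [onPath, Set.mem_iUnion] at h
  exact h.imp fun θ hθ => (mem_paths_iff_mem_senders π).1 hθ

theorem message_injective (σ : Profile Θ A M) : Function.Injective fun π : σ.onPath => π.1.2 := by
  rintro ⟨⟨p, m⟩, h⟩ ⟨⟨q, n⟩, h'⟩ (rfl : m = n)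
  have e1 : p = σ.act m := act_of_onPath h
  have e2 : q = σ.act m := act_of_onPath h'
  subst e1 e2
  rfl

theorem mem_range_message {σ : Profile Θ A M} {θ : Θ} {m : M} (h : σ.send θ m ≠ 0) :
    m ∈ Set.range fun π : σ.onPath => π.1.2 := by
  refine ⟨⟨(σ.act m, m), ?_⟩, rfl⟩
  simp only [onPath, Set.mem_iUnion]
  exact ⟨θ, (PMF.mem_support_iff _ _).2 h, rfl⟩

theorem ncard_edgeSet_eq_sum_senders [Fintype Θ] (σ : Profile Θ A M) {k : ℕ}
    (f : Fin k ≃ σ.onPath) :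
    σ.commGraph.edgeSet.ncard = ∑ i, (σ.senders (f i).1.2).card := by
  classical
  have := Fintype.ofEquiv _ f
  rw [ncard_edgeSet_commGraph, ← f.sum_comp]
  refine Finset.sum_congr rfl fun i _ => ?_
  rw [← Set.ncard_coe_finset]
  congr 1
  ext θ
  simp [mem_paths_iff_mem_senders]

/-- The joint weights of all messages that are sent add up to the prior. -/
theorem sum_flow (σ : Profile Θ A M) (μ : PMF Θ) {k : ℕ} (f : Fin k ≃ σ.onPath) :
    ∑ i, σ.flow μ (f i).1.2 = fun θ => (μ θ).toReal := by
  ext θ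
  have hinj : Function.Injective fun i => (f i).1.2 := σ.message_injective.comp f.injective
  have h1 : ∑' i, σ.send θ (f i).1.2 = ∑' m, σ.send θ m := by
    refine hinj.tsum_eq (f := fun m => σ.send θ m) fun m hm => ?_
    obtain ⟨π, rfl⟩ := mem_range_message (Function.mem_support.1 hm)
    exact ⟨f.symm π, by simp⟩
  rw [PMF.tsum_coe, tsum_fintype] at h1
  simp only [Finset.sum_apply, flow]
  rw [← ENNReal.toReal_sum fun i _ => ENNReal.mul_ne_top (μ.apply_ne_top θ)
    ((σ.send θ).apply_ne_top _), ← Finset.mul_sum, h1, mul_one]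

theorem bind_ne_zero [Fintype Θ] {σ : Profile Θ A M} {μ : PMF Θ} (hμ : ∀ θ, 0 < μ θ)
    (π : σ.onPath) : (μ.bind σ.send) π.1.2 ≠ 0 := by
  obtain ⟨θ, hθ⟩ := exists_mem_senders π
  rw [← PMF.mem_support_iff, PMF.mem_support_bind_iff]
  exact ⟨θ, (PMF.mem_support_iff _ _).2 (hμ θ).ne', mem_senders.1 hθ⟩

theorem one_lt_card_actions [Fintype A] {σ : Profile Θ A M} (π : σ.onPath)
    (hp : ¬ ∃ a, π.1.1 = PMF.pure a) :
    1 < (σ.actions π.1.2).card := by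
  by_contra hlt
  obtain ⟨a, ha⟩ := π.1.1.support_nonempty
  refine hp ⟨a, PMF.ext_toReal fun b => ?_⟩
  rw [act_of_onPath π.2] at ha ⊢
  have hz : ∀ c, c ≠ a → (σ.act π.1.2 c).toReal = 0 := fun c hc => by
    rw [PMF.toReal_eq_zero_iff]
    exact fun hc' => hc (Finset.card_le_one.1 (not_lt.1 hlt) c (mem_actions.2 hc') a
      (mem_actions.2 ha))
  rw [PMF.pure_apply]
  split_ifs with hb
  · rw [hb, ENNReal.toReal_one, ← (σ.act π.1.2).sum_toReal_eq_one]
    exact (Finset.sum_eq_single a (fun c _ hc => hz c hc) (by simp)).symm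
  · rw [hz b hb, ENNReal.toReal_zero]

theorem finrank_le [Fintype Θ] [Fintype A] (σ : Profile Θ A M) (u : A → Θ → ℝ) (m : M) :
    Module.finrank ℝ (indifference u (σ.senders m) (σ.actions m)) ≤ (σ.senders m).card :=
  finrank_indifference_add_le u _ _ (r := 0) (fun j => j.elim0) linearIndependent_empty_type
    fun j => j.elim0

theorem posteriorLaw_apply (σ : Profile Θ A M) (μ : PMF Θ) {k : ℕ} (f : Fin k ≃ σ.onPath)
    (ν : PMF Θ) [∀ i, Decidable (ν = σ.belief (f i).1.2)] :
    σ.posteriorLaw μ ν =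
      ∑ i, if ν = σ.belief (f i).1.2 then (μ.bind σ.send) (f i).1.2 else 0 := by
  classical
  have hinj : Function.Injective fun i => (f i).1.2 := σ.message_injective.comp f.injective
  rw [posteriorLaw, PMF.map_apply, ← hinj.tsum_eq, tsum_fintype]
  · refine Finset.sum_congr rfl fun i _ => ?_
    congr
  · intro m hm
    have hm' : (μ.bind σ.send) m ≠ 0 := by
      intro h0
      exact Function.mem_support.1 hm (by simp only [h0, ite_self])
    rw [← PMF.mem_support_iff, PMF.mem_support_bind_iff] at hm'
    obtain ⟨θ, -, hθ⟩ := hm'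
    obtain ⟨π, rfl⟩ := mem_range_message ((PMF.mem_support_iff _ _).1 hθ)
    exact ⟨f.symm π, by simp⟩

end Profile

/-! ### The dimension count in an equilibrium -/

namespace IsCandidateEq
open Profile
variable {Θ A M : Type*} [Fintype Θ] [Fintype A] {μ : PMF Θ} {u0 : A → M → ℝ} {u : A → Θ → ℝ}
  {σ τ : Profile Θ A M}

/-- By Bayes' rule, with a prior of full support. -/
theorem mem_senders_iff (h : IsCandidateEq μ u0 u σ) (hμ : ∀ θ, 0 < μ θ) (π : σ.onPath) (θ : Θ) :
    θ ∈ σ.senders π.1.2 ↔ θ ∈ (σ.belief π.1.2).support := by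
  have hb := h.bayes π.1.2 θ
  rw [mem_senders, PMF.mem_support_iff, PMF.mem_support_iff]
  have h1 := bind_ne_zero hμ π
  have h2 := (hμ θ).ne'
  constructor <;> intro h3 h4 <;> rw [h4] at hb <;> simp_all

theorem flow_mem_indifference (h : IsCandidateEq μ u0 u σ) (m : M) :
    σ.flow μ m ∈ indifference u (σ.senders m) (σ.actions m) := by
  rw [mem_indifference]
  refine ⟨fun θ hθ => ?_, fun a ha b hb => ?_⟩
  · rw [mem_senders, PMF.mem_support_iff, not_not] at hθ
    simp [flow, hθ]
  · have ea := (h.receiver m).receiverExp_pure_eq (mem_actions.1 ha)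
    have eb := (h.receiver m).receiverExp_pure_eq (mem_actions.1 hb)
    have e := ea.trans eb.symm
    simp only [receiverExp, receiverUtil_pure] at e
    simp only [flow, ← h.bayes, ENNReal.toReal_mul, mul_sub, Finset.sum_sub_distrib]
    simp only [mul_right_comm _ ((μ.bind σ.send) m).toReal, ← Finset.sum_mul]
    rw [e, sub_self]

theorem best_of_mem_actions (h : IsCandidateEq μ u0 u σ) {m : M} {a : A} (ha : a ∈ σ.actions m) :
    IsBestResponse u (PMF.pure a) (σ.belief m) :=
  (h.receiver m).pure_of_mem_support (mem_actions.1 ha)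

theorem finrank_add_one_le (h : IsCandidateEq μ u0 u σ) (hμ : ∀ θ, 0 < μ θ) (hR : AssumptionR u)
    (π : σ.onPath) (hp : ¬ ∃ a, π.1.1 = PMF.pure a) :
    Module.finrank ℝ (indifference u (σ.senders π.1.2) (σ.actions π.1.2)) + 1 ≤
      (σ.senders π.1.2).card := by
  obtain ⟨a, ha, b, hb, hab⟩ := Finset.one_lt_card.1 (one_lt_card_actions π hp)
  exact finrank_indifference_add_le u _ _ (fun _ θ => u a θ - u b θ)
    (hR.linearIndependent hab (h.best_of_mem_actions ha) (h.best_of_mem_actions hb)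
      (h.mem_senders_iff hμ π)) fun _ => ⟨a, ha, b, hb, fun _ => rfl⟩

theorem finrank_add_two_le (h : IsCandidateEq μ u0 u σ) (hμ : ∀ θ, 0 < μ θ)
    (hR : AssumptionRStar u) (π : σ.onPath) (hp : 2 < (σ.actions π.1.2).card) :
    Module.finrank ℝ (indifference u (σ.senders π.1.2) (σ.actions π.1.2)) + 2 ≤
      (σ.senders π.1.2).card := by
  obtain ⟨a, b, c, ha, hb, hc, hab, hac, hbc⟩ := Finset.two_lt_card_iff.1 hp
  refine finrank_indifference_add_le u _ _ _
    (hR.linearIndependent hab hac hbc (h.best_of_mem_actions ha) (h.best_of_mem_actions hb)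
      (h.best_of_mem_actions hc) (h.mem_senders_iff hμ π)) fun j => ?_
  fin_cases j
  · exact ⟨a, ha, b, hb, fun _ => rfl⟩
  · exact ⟨a, ha, c, hc, fun _ => rfl⟩

/-- If one state only sent the message, the indifference subspace would be zero by (R), while it
contains the nonzero vector of joint weights. -/
theorem one_lt_card_senders (h : IsCandidateEq μ u0 u σ) (hμ : ∀ θ, 0 < μ θ) (hR : AssumptionR u)
    (π : σ.onPath) (hp : ¬ ∃ a, π.1.1 = PMF.pure a) : 1 < (σ.senders π.1.2).card := by
  have h1 := h.finrank_add_one_le hμ hR π hp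
  have h2 : 0 < Module.finrank ℝ (indifference u (σ.senders π.1.2) (σ.actions π.1.2)) := by
    obtain ⟨θ, hθ⟩ := exists_mem_senders π
    rw [Module.finrank_pos_iff_exists_ne_zero]
    refine ⟨⟨_, h.flow_mem_indifference π.1.2⟩, fun h0 => ?_⟩
    have h3 := congrFun (congrArg Subtype.val h0) θ
    simp only [flow, ZeroMemClass.coe_zero, Pi.zero_apply, ENNReal.toReal_eq_zero_iff,
      mul_eq_zero] at h3
    rcases h3 with (h3 | h3) | h3
    · exact (hμ θ).ne' h3
    · exact (PMF.mem_support_iff _ _).1 (mem_senders.1 hθ) h3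
    · exact ENNReal.mul_ne_top (μ.apply_ne_top θ) ((σ.send θ).apply_ne_top _) h3
  omega

/-- In an acyclic equilibrium with at most one pure path there are at most `|Θ|² + 1` paths: each
mixed one is identified by a pair of its states. -/
theorem exists_enumeration (h : IsCandidateEq μ u0 u σ) (hμ : ∀ θ, 0 < μ θ) (hR : AssumptionR u)
    (hac : σ.commGraph.IsAcyclic)
    (hpure : ∀ π ρ : σ.onPath, (∃ a, π.1.1 = PMF.pure a) → (∃ a, ρ.1.1 = PMF.pure a) → π = ρ) :
    ∃ k ≤ Fintype.card Θ * Fintype.card Θ + 1, Nonempty (Fin k ≃ σ.onPath) := by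
  classical
  have hpair : ∀ π : σ.onPath, ¬ (∃ a, π.1.1 = PMF.pure a) →
      ∃ x : Θ × Θ, x.1 ≠ x.2 ∧ x.1 ∈ σ.senders π.1.2 ∧ x.2 ∈ σ.senders π.1.2 := by
    intro π hp
    obtain ⟨a, ha, b, hb, hab⟩ := Finset.one_lt_card.1 (h.one_lt_card_senders hμ hR π hp)
    exact ⟨(a, b), hab, ha, hb⟩
  choose g hg using hpair
  let F : σ.onPath → Option (Θ × Θ) := fun π =>
    if hp : ∃ a, π.1.1 = PMF.pure a then none else some (g π hp)
  have hF : Function.Injective F := by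
    intro π ρ hπρ
    by_cases h1 : ∃ a, π.1.1 = PMF.pure a <;> by_cases h2 : ∃ a, ρ.1.1 = PMF.pure a
    · exact hpure π ρ h1 h2
    · simp only [F, dif_pos h1, dif_neg h2, reduceCtorEq] at hπρ
    · simp only [F, dif_pos h2, dif_neg h1, reduceCtorEq] at hπρ
    · simp only [F, dif_neg h1, dif_neg h2, Option.some.injEq] at hπρ
      obtain ⟨hne, m1, m2⟩ := hg π h1
      obtain ⟨-, m3, m4⟩ := hg ρ h2
      rw [← hπρ] at m3 m4
      simp only [← mem_paths_iff_mem_senders] at m1 m2 m3 m4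
      exact eq_of_common_states hac hne m1 m2 m3 m4
  have := Finite.of_injective F hF
  refine ⟨Nat.card σ.onPath, ?_, ⟨(Finite.equivFin _).symm⟩⟩
  simpa [Nat.card_eq_fintype_card] using Nat.card_le_card_of_injective F hF

theorem iSup_indifference_eq_top (h : IsCandidateEq μ u0 u σ)
    (hg : IsGenericPair u fun θ => (μ θ).toReal) {k : ℕ} (f : Fin k ≃ σ.onPath) :
    ⨆ i, indifference u (σ.senders (f i).1.2) (σ.actions (f i).1.2) = ⊤ := by
  refine hg k _ _ ?_
  rw [← sum_flow σ μ f]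
  exact Submodule.sum_mem _ fun i _ =>
    Submodule.mem_iSup_of_mem i (h.flow_mem_indifference _)

theorem card_le_sum_finrank (h : IsCandidateEq μ u0 u σ)
    (hg : IsGenericPair u fun θ => (μ θ).toReal) {k : ℕ} (f : Fin k ≃ σ.onPath) :
    Fintype.card Θ ≤
      ∑ i, Module.finrank ℝ (indifference u (σ.senders (f i).1.2) (σ.actions (f i).1.2)) := by
  obtain ⟨L, -, hL⟩ := exists_surjective_sum_of_iSup_eq_top _ (h.iSup_indifference_eq_top hg f)
  have h1 := LinearMap.finrank_le_finrank_of_surjective hL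
  rwa [Module.finrank_fintype_fun_eq_card, Module.finrank_pi_fintype] at h1

theorem card_add_sum_le (h : IsCandidateEq μ u0 u σ)
    (hg : IsGenericPair u fun θ => (μ θ).toReal) {k : ℕ} (f : Fin k ≃ σ.onPath) (r : Fin k → ℕ)
    (hr : ∀ i, Module.finrank ℝ (indifference u (σ.senders (f i).1.2) (σ.actions (f i).1.2)) +
      r i ≤ (σ.senders (f i).1.2).card) :
    Fintype.card Θ + ∑ i, r i ≤ σ.commGraph.edgeSet.ncard := by
  rw [ncard_edgeSet_eq_sum_senders σ f]
  have h1 := Finset.sum_le_sum fun i (_ : i ∈ Finset.univ) => hr i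
  rw [Finset.sum_add_distrib] at h1
  have h2 := h.card_le_sum_finrank hg f
  omega

/-- When the dimensions add up to at most `|Θ|`, the sum of the indifference subspaces is direct, so
that the supports determine the joint weights. -/
theorem flow_eq_flow (hσ : IsCandidateEq μ u0 u σ) (hτ : IsCandidateEq μ u0 u τ)
    (hg : IsGenericPair u fun θ => (μ θ).toReal) {k : ℕ} (f : Fin k ≃ σ.onPath)
    (g : Fin k ≃ τ.onPath) (hN : ∀ i, σ.senders (f i).1.2 = τ.senders (g i).1.2)
    (hS : ∀ i, σ.actions (f i).1.2 = τ.actions (g i).1.2)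
    (hdim : ∑ i, Module.finrank ℝ (indifference u (σ.senders (f i).1.2) (σ.actions (f i).1.2)) ≤
      Fintype.card Θ) (i : Fin k) : σ.flow μ (f i).1.2 = τ.flow μ (g i).1.2 := by
  classical
  let W : Fin k → Submodule ℝ (Θ → ℝ) :=
    fun i => indifference u (σ.senders (f i).1.2) (σ.actions (f i).1.2)
  obtain ⟨L, hL, hsurj⟩ :=
    exists_surjective_sum_of_iSup_eq_top W (hσ.iSup_indifference_eq_top hg f)
  have hfin : Module.finrank ℝ (∀ i, W i) = Module.finrank ℝ (Θ → ℝ) := by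
    refine le_antisymm ?_ (LinearMap.finrank_le_finrank_of_surjective hsurj)
    rw [Module.finrank_pi_fintype, Module.finrank_fintype_fun_eq_card]
    exact hdim
  have hinj := (LinearMap.injective_iff_surjective_of_finrank_eq_finrank hfin).2 hsurj
  have hτW : ∀ i, τ.flow μ (g i).1.2 ∈ W i := fun i => by
    simp only [W, hN, hS]
    exact hτ.flow_mem_indifference _
  have := @hinj (fun i => ⟨_, hσ.flow_mem_indifference (f i).1.2⟩) (fun i => ⟨_, hτW i⟩)
    (by rw [hL, hL]; exact (sum_flow σ μ f).trans (sum_flow τ μ g).symm)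
  exact congrArg Subtype.val (congrFun this i)

theorem posteriorLaw_eq_of_flow_eq (hσ : IsCandidateEq μ u0 u σ) (hτ : IsCandidateEq μ u0 u τ)
    (hμ : ∀ θ, 0 < μ θ) {k : ℕ} (f : Fin k ≃ σ.onPath) (g : Fin k ≃ τ.onPath)
    (hfl : ∀ i, σ.flow μ (f i).1.2 = τ.flow μ (g i).1.2) :
    σ.posteriorLaw μ = τ.posteriorLaw μ := by
  classical
  have e1 : ∀ i θ, μ θ * σ.send θ (f i).1.2 = μ θ * τ.send θ (g i).1.2 := fun i θ =>
    (ENNReal.toReal_eq_toReal_iff' (ENNReal.mul_ne_top (μ.apply_ne_top θ)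
      ((σ.send θ).apply_ne_top _)) (ENNReal.mul_ne_top (μ.apply_ne_top θ)
      ((τ.send θ).apply_ne_top _))).1 (congrFun (hfl i) θ)
  have e2 : ∀ i, (μ.bind σ.send) (f i).1.2 = (μ.bind τ.send) (g i).1.2 := fun i => by
    simp only [PMF.bind_apply, e1]
  have e3 : ∀ i, σ.belief (f i).1.2 = τ.belief (g i).1.2 := fun i => by
    ext θ
    have h1 := hσ.bayes (f i).1.2 θ
    rw [e1, ← hτ.bayes, e2] at h1
    exact (ENNReal.mul_left_inj (bind_ne_zero hμ (g i)) (PMF.apply_ne_top _ _)).1 h1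
  ext ν
  simp only [posteriorLaw_apply _ μ f, posteriorLaw_apply _ μ g, e2, e3]

end IsCandidateEq

/-! ### Consequences for generic acyclic equilibria -/

namespace Profile
variable {Θ A M : Type*}

theorem natCard_vertices [Fintype Θ] {σ : Profile Θ A M} {k : ℕ} (f : Fin k ≃ σ.onPath) :
    Nat.card (Θ ⊕ σ.onPath) = Fintype.card Θ + k := by
  have : Finite σ.onPath := Finite.of_equiv _ f
  rw [Nat.card_sum, Nat.card_eq_fintype_card, ← Nat.card_congr f, Nat.card_fin]

open Classical in
/-- The number of dimensions that the path `π` is known to cost under (R): none if its action is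
pure, one if it is mixed. -/
noncomputable def mixedRank (σ : Profile Θ A M) (π : σ.onPath) : ℕ :=
  if ∃ a, π.1.1 = PMF.pure a then 0 else 1

theorem le_sum_mixedRank_add_one (σ : Profile Θ A M) {k : ℕ} (f : Fin k ≃ σ.onPath)
    (hpure : ∀ π ρ : σ.onPath, (∃ a, π.1.1 = PMF.pure a) → (∃ a, ρ.1.1 = PMF.pure a) → π = ρ) :
    k ≤ ∑ i, σ.mixedRank (f i) + 1 := by
  classical
  have h1 : ∀ i, σ.mixedRank (f i) + (if ∃ a, (f i).1.1 = PMF.pure a then 1 else 0) = 1 := by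
    intro i
    unfold mixedRank
    split_ifs <;> rfl
  have h2 : ∑ i, (if ∃ a, (f i).1.1 = PMF.pure a then 1 else 0) ≤ 1 := by
    rw [← Finset.card_filter, Finset.card_le_one]
    intro i hi j hj
    simp only [Finset.mem_filter, Finset.mem_univ, true_and] at hi hj
    exact f.injective (hpure _ _ hi hj)
  have h3 := Finset.sum_congr rfl fun i (_ : i ∈ Finset.univ) => h1 i
  rw [Finset.sum_add_distrib] at h3
  simp only [Finset.sum_const, Finset.card_univ, Fintype.card_fin, smul_eq_mul, mul_one] at h3
  omega

end Profile

namespace IsCandidateEq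
open Profile
variable {Θ A M : Type*} [Fintype Θ] [Fintype A] {μ : PMF Θ} {u0 : A → M → ℝ} {u : A → Θ → ℝ}
  {σ : Profile Θ A M}

/-- All messages on path give the sender the same utility, so (S) rules out two pure actions. -/
theorem pure_action_unique (hS : AssumptionS u0) (h : IsCandidateEq μ u0 u σ) {a b : A} {m n : M}
    (ha : (PMF.pure a, m) ∈ σ.onPath) (hb : (PMF.pure b, n) ∈ σ.onPath) : a = b := by
  classical
  have hu : ∀ (c : A) (l : M), senderUtil u0 (PMF.pure c) l = u0 c l := by
    intro c l
    rw [senderUtil, Finset.sum_eq_single c] <;> simp +contextual [PMF.pure_apply]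
  have e1 : PMF.pure a = σ.act m := act_of_onPath ha
  have e2 : PMF.pure b = σ.act n := act_of_onPath hb
  obtain ⟨θ, hθ⟩ := exists_mem_senders ⟨_, ha⟩
  obtain ⟨η, hη⟩ := exists_mem_senders ⟨_, hb⟩
  have h1 := h.sender θ m (mem_senders.1 hθ) n
  have h2 := h.sender η n (mem_senders.1 hη) m
  rw [← e1, ← e2, hu, hu] at h1 h2
  by_contra hab
  exact hS a b hab m n (le_antisymm h2 h1)

theorem pure_path_unique (hS : AssumptionS u0) (h : IsCandidateEq μ u0 u σ) (hirr : σ.Irredundant)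
    (π ρ : σ.onPath) (hπ : ∃ a, π.1.1 = PMF.pure a) (hρ : ∃ a, ρ.1.1 = PMF.pure a) : π = ρ := by
  obtain ⟨⟨p, m⟩, hp⟩ := π
  obtain ⟨⟨q, n⟩, hq⟩ := ρ
  obtain ⟨a, rfl : p = PMF.pure a⟩ := hπ
  obtain ⟨b, rfl : q = PMF.pure b⟩ := hρ
  obtain rfl := h.pure_action_unique hS hp hq
  obtain rfl := hirr a m n hp hq
  rfl

theorem finrank_add_mixedRank_le (h : IsCandidateEq μ u0 u σ) (hμ : ∀ θ, 0 < μ θ)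
    (hR : AssumptionR u) (π : σ.onPath) :
    Module.finrank ℝ (indifference u (σ.senders π.1.2) (σ.actions π.1.2)) + σ.mixedRank π ≤
      (σ.senders π.1.2).card := by
  unfold mixedRank
  split_ifs with hp
  · exact finrank_le σ u π.1.2
  · exact h.finrank_add_one_le hμ hR π hp

theorem noForestEq (hS : AssumptionS u0) (hμ : ∀ θ, 0 < μ θ) (hR : AssumptionR u)
    (hg : IsGenericPair u fun θ => (μ θ).toReal) : NoForestEq μ u0 u := by
  rintro ⟨σ, h, hirr, hac, hcon⟩
  have hpure := h.pure_path_unique hS hirr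
  obtain ⟨k, -, ⟨f⟩⟩ := h.exists_enumeration hμ hR hac hpure
  obtain ⟨θ, -⟩ := μ.support_nonempty
  have : Nonempty (Θ ⊕ σ.onPath) := ⟨Sum.inl θ⟩
  have : Finite σ.onPath := Finite.of_equiv _ f
  have h1 := hac.ncard_edgeSet_add_two_le hcon
  have h2 := h.card_add_sum_le hg f _ fun i => h.finrank_add_mixedRank_le hμ hR (f i)
  have h3 := σ.le_sum_mixedRank_add_one f hpure
  rw [natCard_vertices f] at h1
  omega

theorem onePureAction (hS : AssumptionS u0) (hμ : ∀ θ, 0 < μ θ) (hR : AssumptionR u)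
    (hg : IsGenericPair u fun θ => (μ θ).toReal) : OnePureAction μ u0 u := by
  intro σ h hac
  by_cases hex : ∃ a : A, ∃ m : M, (PMF.pure a, m) ∈ σ.onPath
  · obtain ⟨a, m, ha⟩ := hex
    exact ⟨a, ⟨m, ha⟩, fun b ⟨n, hb⟩ => h.pure_action_unique hS hb ha⟩
  exfalso
  have hno : ∀ π : σ.onPath, ¬ ∃ a, π.1.1 = PMF.pure a := by
    rintro ⟨⟨p, m⟩, hp⟩ ⟨a, rfl : p = PMF.pure a⟩
    exact hex ⟨a, m, hp⟩
  obtain ⟨k, -, ⟨f⟩⟩ := h.exists_enumeration hμ hR hac fun π _ hπ => (hno π hπ).elim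
  obtain ⟨θ, -⟩ := μ.support_nonempty
  have : Nonempty (Θ ⊕ σ.onPath) := ⟨Sum.inl θ⟩
  have : Finite σ.onPath := Finite.of_equiv _ f
  have h1 := hac.ncard_edgeSet_add_one_le
  have h2 := h.card_add_sum_le hg f (fun _ => 1) fun i => h.finrank_add_one_le hμ hR (f i) (hno _)
  rw [natCard_vertices f] at h1
  simp only [Finset.sum_const, Finset.card_univ, Fintype.card_fin, smul_eq_mul, mul_one] at h2
  omega

theorem mixedActionsBinary (hS : AssumptionS u0) (hμ : ∀ θ, 0 < μ θ) (hR : AssumptionRStar u)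
    (hg : IsGenericPair u fun θ => (μ θ).toReal) : MixedActionsBinary μ u0 u := by
  classical
  intro σ h hirr hac π hπ hmix
  have hpure := h.pure_path_unique hS hirr
  obtain ⟨k, -, ⟨f⟩⟩ := h.exists_enumeration hμ hR.assumptionR hac hpure
  have hcard : π.1.support.ncard = (σ.actions π.2).card := by
    rw [← Set.ncard_coe_finset]
    congr 1
    ext a
    rw [Finset.mem_coe, mem_actions, act_of_onPath hπ]
  have hlt := one_lt_card_actions ⟨π, hπ⟩ hmix
  rw [hcard]
  by_contra hne
  -- a third action in the support costs one more dimension than the count allows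
  let i₀ := f.symm ⟨π, hπ⟩
  have hi₀ : f i₀ = ⟨π, hπ⟩ := f.apply_symm_apply _
  have h2 := h.card_add_sum_le hg f
    (fun i => σ.mixedRank (f i) + if i = i₀ then 1 else 0) fun i => by
      by_cases hi : i = i₀
      · have hr : σ.mixedRank ⟨π, hπ⟩ = 1 := if_neg hmix
        rw [if_pos hi, hi, hi₀, hr]
        exact h.finrank_add_two_le hμ hR ⟨π, hπ⟩ (by simp only at hlt ⊢; omega)
      · simpa [hi] using h.finrank_add_mixedRank_le hμ hR.assumptionR (f i)
  obtain ⟨θ, -⟩ := μ.support_nonempty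
  have : Nonempty (Θ ⊕ σ.onPath) := ⟨Sum.inl θ⟩
  have : Finite σ.onPath := Finite.of_equiv _ f
  have h1 := hac.ncard_edgeSet_add_one_le
  have h3 := σ.le_sum_mixedRank_add_one f hpure
  rw [natCard_vertices f] at h1
  simp only [Finset.sum_add_distrib, Finset.sum_ite_eq', Finset.mem_univ, if_true] at h2
  omega

/-- The bound opposite to `card_le_sum_finrank`, from the number of edges of a forest. -/
theorem sum_finrank_le_card (hS : AssumptionS u0) (h : IsCandidateEq μ u0 u σ)
    (hμ : ∀ θ, 0 < μ θ) (hR : AssumptionR u) (hirr : σ.Irredundant)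
    (hac : σ.commGraph.IsAcyclic) {k : ℕ} (f : Fin k ≃ σ.onPath) :
    ∑ i, Module.finrank ℝ (indifference u (σ.senders (f i).1.2) (σ.actions (f i).1.2)) ≤
      Fintype.card Θ := by
  obtain ⟨θ, -⟩ := μ.support_nonempty
  have : Nonempty (Θ ⊕ σ.onPath) := ⟨Sum.inl θ⟩
  have : Finite σ.onPath := Finite.of_equiv _ f
  have h1 := hac.ncard_edgeSet_add_one_le
  rw [natCard_vertices f, ncard_edgeSet_eq_sum_senders σ f] at h1
  have h2 := Finset.sum_le_sum fun i (_ : i ∈ Finset.univ) =>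
    h.finrank_add_mixedRank_le hμ hR (f i)
  rw [Finset.sum_add_distrib] at h2
  have h3 := σ.le_sum_mixedRank_add_one f (h.pure_path_unique hS hirr)
  omega

theorem posteriorLaw_eq (hS : AssumptionS u0) (hμ : ∀ θ, 0 < μ θ) (hR : AssumptionR u)
    (hg : IsGenericPair u fun θ => (μ θ).toReal) {τ : Profile Θ A M}
    (hσ : IsCandidateEq μ u0 u σ) (hτ : IsCandidateEq μ u0 u τ) (hirr : σ.Irredundant)
    (hac : σ.commGraph.IsAcyclic) {k : ℕ} (f : Fin k ≃ σ.onPath) (g : Fin k ≃ τ.onPath)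
    (hN : ∀ i, σ.senders (f i).1.2 = τ.senders (g i).1.2)
    (hA : ∀ i, σ.actions (f i).1.2 = τ.actions (g i).1.2) :
    σ.posteriorLaw μ = τ.posteriorLaw μ :=
  hσ.posteriorLaw_eq_of_flow_eq hτ hμ f g <|
    hσ.flow_eq_flow hτ hg f g hN hA (hσ.sum_finrank_le_card hS hμ hR hirr hac f)

theorem finitelyManyIdentified (hS : AssumptionS u0) (hμ : ∀ θ, 0 < μ θ) (hR : AssumptionR u)
    (hg : IsGenericPair u fun θ => (μ θ).toReal) : FinitelyManyIdentified μ u0 u := by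
  classical
  constructor
  · let Q : (k : ℕ) → (Fin k → Finset Θ) → (Fin k → Finset A) → Set (PMF (PMF Θ)) := fun k N T =>
      {L | ∃ σ : Profile Θ A M, IsCandidateEq μ u0 u σ ∧ σ.Irredundant ∧ σ.commGraph.IsAcyclic ∧
        σ.posteriorLaw μ = L ∧ ∃ f : Fin k ≃ σ.onPath,
          (∀ i, σ.senders (f i).1.2 = N i) ∧ ∀ i, σ.actions (f i).1.2 = T i}
    have hQ : ∀ k N T, (Q k N T).Subsingleton := by
      rintro k N T _ ⟨σ, h, hirr, hac, rfl, f, hN, hT⟩ _ ⟨τ, h', -, -, rfl, g, hN', hT'⟩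
      exact posteriorLaw_eq hS hμ hR hg h h' hirr hac f g (fun i => by rw [hN, hN'])
        fun i => by rw [hT, hT']
    refine ((Set.finite_Iic (Fintype.card Θ * Fintype.card Θ + 1)).biUnion
      (t := fun k => ⋃ N, ⋃ T, Q k N T) fun k _ =>
      Set.finite_iUnion fun N => Set.finite_iUnion fun T => (hQ k N T).finite).subset ?_
    rintro L ⟨σ, h, hirr, hac, hL⟩
    obtain ⟨k, hk, ⟨f⟩⟩ := h.exists_enumeration hμ hR hac (h.pure_path_unique hS hirr)
    simp only [Set.mem_iUnion]
    exact ⟨k, hk, _, _, σ, h, hirr, hac, hL, f, fun i => rfl, fun i => rfl⟩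
  · intro σ τ h hirr hac h' _ _ ⟨e, he⟩
    obtain ⟨k, -, ⟨f⟩⟩ := h.exists_enumeration hμ hR hac (h.pure_path_unique hS hirr)
    refine posteriorLaw_eq hS hμ hR hg h h' hirr hac f (f.trans e) (fun i => ?_) fun i => ?_
    · ext θ
      rw [← mem_paths_iff_mem_senders, ← mem_paths_iff_mem_senders]
      exact (he (f i)).2 θ
    · ext a
      rw [mem_actions, mem_actions, ← act_of_onPath (f i).2, ← act_of_onPath ((f.trans e) i).2]
      exact ((congrArg (fun p => a ∈ PMF.support p) (he (f i)).1)).to_iff.symm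

end IsCandidateEq

/-- Normalizing a weight vector to a prior does not affect membership in a subspace. -/
theorem forGenericPrior_of_isGenericPair {Θ A : Type*} [Fintype Θ] [Fintype A] (u : A → Θ → ℝ)
    {P : PMF Θ → Prop}
    (hP : ∀ μ : PMF Θ, (∀ θ, 0 < μ θ) → IsGenericPair u (fun θ => (μ θ).toReal) → P μ) :
    ForGenericPrior P := by
  filter_upwards [ae_isGenericPair u] with w hw hpos μ hμ
  obtain ⟨θ₀, -⟩ := μ.support_nonempty
  have hsum : 0 < ∑ i, w i := Finset.sum_pos (fun i _ => hpos i) ⟨θ₀, Finset.mem_univ _⟩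
  refine hP μ (fun θ => ?_) ?_
  · have h : 0 < (μ θ).toReal := hμ θ ▸ div_pos (hpos θ) hsum
    exact (ENNReal.toReal_pos_iff.1 h).1
  · convert hw.smul (inv_ne_zero hsum.ne') using 1
    ext θ
    rw [hμ θ, Pi.smul_apply, smul_eq_mul, div_eq_inv_mul]

theorem theorem1 {Θ A M : Type*} [Fintype Θ] [Fintype A]
    (u0 : A → M → ℝ) (hS : AssumptionS u0) :
    (∀ μ : PMF Θ, (∀ θ, 0 < μ θ) →
      ∀ᵐ uR : A → Θ → ℝ,
        NoForestEq μ u0 uR ∧ OnePureAction μ u0 uR ∧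
        MixedActionsBinary μ u0 uR ∧ FinitelyManyIdentified μ u0 uR) ∧
    (∀ uR : A → Θ → ℝ, AssumptionR uR →
      ForGenericPrior fun μ => NoForestEq μ u0 uR ∧ OnePureAction μ u0 uR) ∧
    (∀ uR : A → Θ → ℝ, AssumptionRStar uR →
      ForGenericPrior fun μ =>
        NoForestEq μ u0 uR ∧ OnePureAction μ u0 uR ∧
        MixedActionsBinary μ u0 uR ∧ FinitelyManyIdentified μ u0 uR) := by
  have all : ∀ (μ : PMF Θ) (uR : A → Θ → ℝ), (∀ θ, 0 < μ θ) → AssumptionRStar uR →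
      IsGenericPair uR (fun θ => (μ θ).toReal) → NoForestEq μ u0 uR ∧ OnePureAction μ u0 uR ∧
        MixedActionsBinary μ u0 uR ∧ FinitelyManyIdentified μ u0 uR := fun μ uR hμ hR hg =>
    ⟨IsCandidateEq.noForestEq hS hμ hR.assumptionR hg,
      IsCandidateEq.onePureAction hS hμ hR.assumptionR hg,
      IsCandidateEq.mixedActionsBinary hS hμ hR hg,
      IsCandidateEq.finitelyManyIdentified hS hμ hR.assumptionR hg⟩
  refine ⟨fun μ hμ => ?_, fun uR hR => ?_, fun uR hR => ?_⟩
  · filter_upwards [ae_assumptionRStar, ae_isGenericPair_of_pos (fun θ => (μ θ).toReal)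
      fun θ => ENNReal.toReal_pos (hμ θ).ne' (μ.apply_ne_top θ)] with uR hR hg
    exact all μ uR hμ hR hg
  · exact forGenericPrior_of_isGenericPair uR fun μ hμ hg =>
      ⟨IsCandidateEq.noForestEq hS hμ hR hg, IsCandidateEq.onePureAction hS hμ hR hg⟩
  · exact forGenericPrior_of_isGenericPair uR fun μ hμ hg => all μ uR hμ hR hg
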